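/- **Setting.** Let $P,U$ be probability measures on a measurable space $\mathcal X$ with $P\ll U$ ($P$: the law of the real observations; $U$: the reference law, typically uniform). Let $\pi\in(0,1)$ and $M=\pi P+(1-\pi)U$, and let $\eta^\star=\pi\,dP/dM$ be the Bayes posterior of the binary task $(\pi,P,U)$. Matusita's loss has partial losses $\ell_{-1}(u)=\sqrt{u/(1-u)}$ and $\ell_1(u)=\ell_{-1}(1-u)$, pointwise risk $L(v,\eta)=\eta\,\ell_1(v)+(1-\eta)\,\ell_{-1}(v)$, Bayes risk $\underline L(\eta)=\inf_{v\in[0,1]}L(v,\eta)$ (which equals $2\sqrt{\eta(1-\eta)}$), and full risk $\mathbb L(v,\eta,M)=\mathbb E_{x\sim M}L(v(x),\eta(x))$. For $\varepsilon\in[0,1]$ put $$L_\varepsilon=\varepsilon\,\underline L(\pi)+(1-\varepsilon)\,\mathbb L(\eta^\star,\eta^\star,M),\qquad f^\pi(t)=\underline L(\pi)-(\pi t+1-\pi)\,\underline L\!\left(\frac{\pi t}{\pi t+1-\pi}\right),$$ $$I_{f^\pi}(P,U)=\int f^\pi\!\left(\frac{dP}{dU}\right)dU .$$ With $F(z)=-g(z)\,\underline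 L(z/g(z))$, $g(z)=z+\frac{1-\pi}{\pi}$, and the Bregman divergence $B_F(z\|z')=F(z)-F(z')-(z-z')F'(z')$ (equal to $0$ if $z=z'=0$), the likelihood-ratio risk of a measure $Q\ll U$ is $$R(P,Q)=\pi\,\mathbb E_U\!\left[B_F\!\left(\tfrac{dP}{dU}\,\Big\|\,\tfrac{dQ}{dU}\right)\right].$$ **Discriminator.** For each leaf region $B\subseteq\mathcal X$ let $\mathcal F(B)$ be the class of measurable binary tests that may be used to split a leaf with region $B$ (for instance, one class for all leaves, or a single chosen test per leaf). Starting from the single-root tree $h_0$, the decision trees $h_1,\dots,h_T$ are grown by the greedy top-down induction of Kearns and Mansour: $h_{t+1}$ is obtained from $h_t$ by the split which, among all pairs (leaf of $h_t$ with region $B$, test in $\mathcal F(B)$), minimizes $\mathbb L(\tilde\eta,\tilde\eta,M)$, where $\tilde\eta$ is the calibrated posterior of the new tree, i.e. the prediction $\pi P(B)/M(B)$ at each leaf with region $B$. **Weak Hypothesis Assumption.** Let $\delta>0$. A test $\mathtt t$ satisfies the $\delta$-WHA at a leaf with region $B$ if $\tfrac12P(\mathtt t=\text{false}\mid B)+\tfrac12U(\mathtt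 t=\text{true}\mid B)\le\tfrac12-\delta$, i.e. if its error as a predictor of real (true) versus fake (false) on the balanced mixture of $P(\cdot\mid B)$ and $U(\cdot\mid B)$ is at most $\tfrac12-\delta$. Assume that, for each $t<T$ and each leaf of $h_t$ with region $B$ such that $P(B)>0$, some test in $\mathcal F(B)$ satisfies the $\delta$-WHA. **Generator.** The copycat generator $G$ of $h_T$ is the generative tree with the same underlying tree and tests as $h_T$, in which the probability of the right (true) arc at an internal node with region $A$ and test $\mathtt t$ is $P(A\cap\{\mathtt t=\text{true}\})/P(A)$. It generates an observation by descending the tree at random and then sampling from $U(\cdot\mid B)$, where $B$ is the region of the leaf reached. We also write $G$ for the law of this observation. **Theorem.** For every $\varepsilon\in[0,1]$, if the number of splits satisfies $T\ge(1/L_\varepsilon)^{32/\delta^2}$, then the integrand defining $R(P,G)$ is $U$-integrable and $$R(P,G)\le\varepsilon\cdot I_{f^\pi}(P,U).$$ -/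

import Mathlib

open MeasureTheory Set
open scoped ENNReal ProbabilityTheory

noncomputable section

namespace Copycat

/-! ### Losses for class probability estimation -/

/-- A loss for class probability estimation, given by its partial losses for the classes `1` (real)
and `-1` (fake). They are `[0, ∞]`-valued, since e.g. Matusita's loss is infinite at an endpoint. -/
structure Loss where
  /-- partial loss for class `1` -/
  pos : ℝ → ℝ≥0∞
  /-- partial loss for class `-1` -/
  neg : ℝ → ℝ≥0∞

/-- Matusita's loss: symmetric, with `ℓ₋₁(u) = √(u / (1 - u))` (equal to `∞` at `u = 1`). -/
def matusita : Loss where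
  pos u := (ENNReal.ofReal (1 - u) / ENNReal.ofReal u) ^ (1 / 2 : ℝ)
  neg u := (ENNReal.ofReal u / ENNReal.ofReal (1 - u)) ^ (1 / 2 : ℝ)

/-- Pointwise conditional risk `L(v, η) = η ℓ₁(v) + (1 - η) ℓ₋₁(v)` (with `0 * ∞ = 0`). -/
def Loss.pointRisk (ℓ : Loss) (v η : ℝ) : ℝ≥0∞ :=
  ENNReal.ofReal η * ℓ.pos v + ENNReal.ofReal (1 - η) * ℓ.neg v

/-- Pointwise Bayes risk: the infimum of `L(v, η)` over `v ∈ [0, 1]`. -/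
def Loss.bayesRisk (ℓ : Loss) (η : ℝ) : ℝ :=
  (⨅ v ∈ Icc (0 : ℝ) 1, ℓ.pointRisk v η).toReal

theorem matusita_pointRisk_of_mem {v η : ℝ} (hv : v ∈ Ioo (0 : ℝ) 1) (hη : η ∈ Icc (0 : ℝ) 1) :
    matusita.pointRisk v η =
      ENNReal.ofReal (η * √((1 - v) / v) + (1 - η) * √(v / (1 - v))) := by
  have h0 := hv.1
  have h1 : 0 < 1 - v := sub_pos.2 hv.2
  have h2 : 0 ≤ 1 - η := sub_nonneg.2 hη.2
  have e0 := hη.1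
  simp only [Loss.pointRisk, matusita]
  rw [← ENNReal.ofReal_div_of_pos h0, ← ENNReal.ofReal_div_of_pos h1,
    ENNReal.ofReal_rpow_of_nonneg (by positivity) (by norm_num),
    ENNReal.ofReal_rpow_of_nonneg (by positivity) (by norm_num),
    ← Real.sqrt_eq_rpow, ← Real.sqrt_eq_rpow, ← ENNReal.ofReal_mul e0, ← ENNReal.ofReal_mul h2,
    ← ENNReal.ofReal_add (by positivity) (by positivity)]

/-- The Bayes risk of Matusita's loss. -/
theorem matusita_bayesRisk {η : ℝ} (hη : η ∈ Icc (0 : ℝ) 1) :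
    matusita.bayesRisk η = 2 * √(η * (1 - η)) := by
  have h2 : 0 ≤ 1 - η := sub_nonneg.2 hη.2
  have e0 := hη.1
  have key : (⨅ v ∈ Icc (0 : ℝ) 1, matusita.pointRisk v η) =
      ENNReal.ofReal (2 * √(η * (1 - η))) := by
    apply le_antisymm
    · refine (iInf₂_le η hη).trans ?_
      rcases e0.eq_or_lt with rfl | e0
      · simp [Loss.pointRisk, matusita]
      rcases h2.eq_or_lt with h2 | h2
      · have : η = 1 := by linarith
        subst this
        simp [Loss.pointRisk, matusita]
      rw [matusita_pointRisk_of_mem ⟨e0, by linarith⟩ hη]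
      apply le_of_eq
      congr 1
      rw [Real.sqrt_div h2.le, Real.sqrt_div e0.le, Real.sqrt_mul e0.le]
      have a := Real.sqrt_pos.2 e0
      have b := Real.sqrt_pos.2 h2
      field_simp
      rw [Real.sq_sqrt e0.le, Real.sq_sqrt h2.le]
      ring
    · refine le_iInf₂ fun v hv => ?_
      rcases hv.1.eq_or_lt with rfl | h0
      · rcases e0.eq_or_lt with rfl | e0
        · simp
        · simp [Loss.pointRisk, matusita, ENNReal.mul_top, e0]
      rcases hv.2.eq_or_lt with rfl | h1
      · rcases h2.eq_or_lt with h2 | h2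
        · simp [← h2]
        · simp only [sub_pos] at h2
          simp [Loss.pointRisk, matusita, ENNReal.mul_top, h2]
      rw [matusita_pointRisk_of_mem ⟨h0, h1⟩ hη]
      apply ENNReal.ofReal_le_ofReal
      have h1' : 0 < 1 - v := sub_pos.2 h1
      have a := Real.sqrt_pos.2 h0
      have b := Real.sqrt_pos.2 h1'
      rw [Real.sqrt_div h1'.le, Real.sqrt_div h0.le, Real.sqrt_mul e0]
      have hp := Real.sq_sqrt e0
      have hq := Real.sq_sqrt h2
      have : η * (√(1 - v) / √v) + (1 - η) * (√v / √(1 - v)) - 2 * (√η * √(1 - η)) =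
          (√η * √(1 - v) - √(1 - η) * √v) ^ 2 / (√v * √(1 - v)) := by
        nth_rewrite 1 [← hp]
        nth_rewrite 1 [← hq]
        field_simp
        ring
      have : 0 ≤ (√η * √(1 - v) - √(1 - η) * √v) ^ 2 / (√v * √(1 - v)) := by positivity
      linarith
  rw [Loss.bayesRisk, key, ENNReal.toReal_ofReal (by positivity)]

variable {X : Type*} [MeasurableSpace X]

/-- Full risk `E_{x ∼ M} L(v(x), η(x))`. -/
def Loss.popRisk (ℓ : Loss) (v η : X → ℝ) (M : Measure X) : ℝ :=
  (∫⁻ x, ℓ.pointRisk (v x) (η x) ∂M).toReal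

/-! ### The binary task `(π, P, U)` -/

/-- The mixture `M = π P + (1 - π) U`. -/
def mixture (π : ℝ) (P U : Measure X) : Measure X :=
  ENNReal.ofReal π • P + ENNReal.ofReal (1 - π) • U

/-- Bayes posterior `η⋆ = π dP/dM`. -/
def bayesPosterior (π : ℝ) (P U : Measure X) (x : X) : ℝ :=
  π * (P.rnDeriv (mixture π P U) x).toReal

/-- The interpolated risk `ε L(π) + (1 - ε) L(η⋆, η⋆, M)`, where `L(π)` is the Bayes risk at `π`. -/
def Loss.riskLevel (ℓ : Loss) (ε π : ℝ) (P U : Measure X) : ℝ :=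
  ε * ℓ.bayesRisk π +
    (1 - ε) * ℓ.popRisk (bayesPosterior π P U) (bayesPosterior π P U) (mixture π P U)

/-- The generator `f^π` of the divergence attached to the loss and the prior `π`. -/
def Loss.fPrior (ℓ : Loss) (π t : ℝ) : ℝ :=
  ℓ.bayesRisk π - (π * t + 1 - π) * ℓ.bayesRisk (π * t / (π * t + 1 - π))

/-- The `f`-divergence `∫ f(dP/dU) dU` (for `P` absolutely continuous with respect to `U`). -/
def fDivergence (f : ℝ → ℝ) (P U : Measure X) : ℝ :=
  ∫ x, f (P.rnDeriv U x).toReal ∂U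

/-! ### Likelihood ratio risk -/

/-- Bregman divergence `B_F(z ‖ z')`. -/
def bregman (F : ℝ → ℝ) (z z' : ℝ) : ℝ :=
  F z - F z' - (z - z') * deriv F z'

/-- Generalized perspective transform of `F` given `g`. -/
def perspective (g F : ℝ → ℝ) (z : ℝ) : ℝ :=
  g z * F (z / g z)

/-- The pointwise Bregman divergence between `dP/dU` and `dQ/dU`, whose generator is the perspective
transform, given `g(z) = z + (1 - π) / π`, of the negative Bayes risk. -/
def Loss.ratioDivergence (ℓ : Loss) (π : ℝ) (P Q U : Measure X) (x : X) : ℝ :=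
  bregman (perspective (fun z => z + (1 - π) / π) (fun u => -ℓ.bayesRisk u))
    (P.rnDeriv U x).toReal (Q.rnDeriv U x).toReal

/-- The likelihood ratio risk of `Q` with respect to `P`, with reference measure `U`. -/
def Loss.likelihoodRatioRisk (ℓ : Loss) (π : ℝ) (P Q U : Measure X) : ℝ :=
  π * ∫ x, ℓ.ratioDivergence π P Q U x ∂U

/-! ### Trees -/

/-- The graph of a binary tree whose internal nodes carry a test; the test is the set of the
observations that satisfy it. They follow the right arc, the other ones follow the left arc. -/
inductive Tree (X : Type*) where
  | leaf : Tree X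
  | node (s : Set X) (l r : Tree X) : Tree X

/-- The regions of the leaves of a tree whose root has region `A`. -/
def Tree.leafRegions {X : Type*} : Tree X → Set X → List (Set X)
  | .leaf, A => [A]
  | .node s l r, A => l.leafRegions (A \ s) ++ r.leafRegions (A ∩ s)

/-- `Tree.Split h A B s h'`: if the root of `h` has region `A`, then replacing one leaf of `h`, of
region `B`, by an internal node with test `s` and two leaves gives `h'`. -/
inductive Tree.Split {X : Type*} : Tree X → Set X → Set X → Set X → Tree X → Prop
  | leaf (A s : Set X) : Tree.Split .leaf A A s (.node s .leaf .leaf)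
  | left {t A B s : Set X} {l l' r : Tree X} (h : Tree.Split l (A \ t) B s l') :
      Tree.Split (.node t l r) A B s (.node t l' r)
  | right {t A B s : Set X} {l r r' : Tree X} (h : Tree.Split r (A ∩ t) B s r') :
      Tree.Split (.node t l r) A B s (.node t l r')

open Classical in
/-- The calibrated posterior of the decision tree `h` (rooted at the region `A`): a leaf of region
`B` predicts `π P(B) / M(B)`. -/
def Tree.posterior (π : ℝ) (P U : Measure X) : Tree X → Set X → X → ℝ
  | .leaf, A, _ => π * P.real A / (mixture π P U).real A
  | .node s l r, A, x =>
      if x ∈ s then r.posterior π P U (A ∩ s) x else l.posterior π P U (A \ s) x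

/-- The risk `L(η_h, η_h, M)` of the calibrated posterior `η_h` of the decision tree `h`, which
top-down induction minimizes (equivalently, it maximizes the information of `η_h`). -/
def Tree.risk (ℓ : Loss) (π : ℝ) (P U : Measure X) (h : Tree X) : ℝ :=
  ℓ.popRisk (h.posterior π P U univ) (h.posterior π P U univ) (mixture π P U)

/-- One iteration of greedy top-down induction, `F B` being the class of the tests that may be used
at a leaf of region `B`: among all the pairs (leaf, test), the split realizes the smallest risk. -/
def TopDownStep (ℓ : Loss) (π : ℝ) (P U : Measure X) (F : Set X → Set (Set X))
    (h h' : Tree X) : Prop :=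
  ∃ B s, s ∈ F B ∧ h.Split univ B s h' ∧
    ∀ B' s' h'', s' ∈ F B' → h.Split univ B' s' h'' → h'.risk ℓ π P U ≤ h''.risk ℓ π P U

/-- The probability of `t(x) ≠ y`, for the test `t` with set `s` read as predicting 'real' on `s` and
'fake' off `s`, when `(x, y)` is drawn from the balanced mixture at `B`: with probability `1/2`, `y`
is 'real' and `x` is drawn from `P` given `B`, else `y` is 'fake' and `x` is drawn from `U` given `B`. -/
def balancedError (P U : Measure X) (B s : Set X) : ℝ :=
  1 / 2 * (P[|B]).real sᶜ + 1 / 2 * (U[|B]).real s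

/-- The test `s` satisfies the `δ`-Weak Hypothesis Assumption at a leaf of region `B`. -/
def WeakHypothesis (δ : ℝ) (P U : Measure X) (B s : Set X) : Prop :=
  balancedError P U B s ≤ 1 / 2 - δ

/-! ### Generative trees and copycat training -/

/-- A generative tree: each internal node carries, with its test, the probability `p` of its right
arc (so that `1 - p` is the probability of its left arc). -/
inductive GenTree (X : Type*) where
  | leaf : GenTree X
  | node (s : Set X) (p : unitInterval) (l r : GenTree X) : GenTree X

/-- The law of an observation generated by a generative tree (rooted at the region `A`): go down
the tree at random, then sample from `U` conditioned on the region of the leaf reached. -/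
def GenTree.law (U : Measure X) : GenTree X → Set X → Measure X
  | .leaf, A => U[|A]
  | .node s p l r, A =>
      ENNReal.ofReal (1 - p) • l.law U (A \ s) + ENNReal.ofReal p • r.law U (A ∩ s)

/-- The proportion, among the real observations that reach the region `A`, of those passing `s`. -/
def splitProb (P : Measure X) [IsProbabilityMeasure P] (A s : Set X) : unitInterval :=
  ⟨P.real (A ∩ s) / P.real A,
    div_nonneg measureReal_nonneg measureReal_nonneg,
    div_le_one_of_le₀ (measureReal_mono inter_subset_left) measureReal_nonneg⟩

/-- The copycat generator of a decision tree (rooted at `A`): it has the same graph, and the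
probability at each arc is the proportion of the real observations that follow it. -/
def Tree.copycat (P : Measure X) [IsProbabilityMeasure P] : Tree X → Set X → GenTree X
  | .leaf, _ => .leaf
  | .node s l r, A =>
      .node s (splitProb P A s) (l.copycat P (A \ s)) (r.copycat P (A ∩ s))

/-- The measure induced by the copycat generator of the decision tree `h`. -/
def copycatMeasure (P U : Measure X) [IsProbabilityMeasure P] (h : Tree X) : Measure X :=
  (h.copycat P univ).law U univ

end Copycat

end

noncomputable section

namespace Copycat

/-! ### Matusita's loss -/

/-! For Matusita's loss every quantity is governed by a Bhattacharyya affinity. Put c = 2√(π(1-π)),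
H = ∫ √(dP/dU) dU, and Z(h) = Σ √(P(B)U(B)) over the leaf regions B of h. Then I_f = c(1 - H), L_ε =
c(ε + (1-ε)H), the tree risk is cZ(h), and the copycat generator has likelihood-ratio risk exactly
c(Z(h) - H) (`likelihoodRatioRisk_copycat`). The claim therefore reduces to Z(h_T) ≤ ε + (1-ε)H.

Since risk is a positive multiple of Z, greedy induction minimizes Z. A test satisfying the δ-WHA
shrinks the weight of its leaf by a factor at most 1 - 2δ² (`regionWeight_split_le`). Among the t+1
leaves of h_t one has at least the average weight, so Z(h_{t+1}) ≤ (1 - 2δ²/(t+1)) Z(h_t)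
(`TopDownStep.affinity_le`). Iterating gives Z(h_T) ≤ (T+1)^(-2δ²) (`affinity_topDown_le`), which
the lower bound on T makes small enough. -/

theorem matusita_pointRisk_self {η : ℝ} (hη : η ∈ Icc (0 : ℝ) 1) :
    matusita.pointRisk η η = ENNReal.ofReal (2 * √(η * (1 - η))) := by
  have h2 : 0 ≤ 1 - η := sub_nonneg.2 hη.2
  have e0 := hη.1
  rcases e0.eq_or_lt with rfl | e0
  · simp [Loss.pointRisk, matusita]
  rcases h2.eq_or_lt with h2 | h2
  · have : η = 1 := by linarith
    subst this
    simp [Loss.pointRisk, matusita]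
  rw [matusita_pointRisk_of_mem ⟨e0, by linarith⟩ hη]
  congr 1
  rw [Real.sqrt_div h2.le, Real.sqrt_div e0.le, Real.sqrt_mul e0.le]
  have a := Real.sqrt_pos.2 e0
  have b := Real.sqrt_pos.2 h2
  field_simp
  rw [Real.sq_sqrt e0.le, Real.sq_sqrt h2.le]
  ring

/-- For `a, b ≥ 0` the scaled Bayes risk at the ratio `a / (a + b)` is `2 √(a b)`. -/
theorem add_mul_two_sqrt_ratio {a b : ℝ} (ha : 0 ≤ a) (hb : 0 ≤ b) :
    (a + b) * (2 * √(a / (a + b) * (1 - a / (a + b)))) = 2 * √(a * b) := by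
  rcases (add_nonneg ha hb).eq_or_lt with h | h
  · have : a = 0 := by linarith
    simp [this]
  · have e : a / (a + b) * (1 - a / (a + b)) = a * b / (a + b) ^ 2 := by
      field_simp
      ring
    rw [e, Real.sqrt_div' _ (sq_nonneg _), Real.sqrt_sq h.le]
    field_simp

theorem ratio_mem_Icc {a b : ℝ} (ha : 0 ≤ a) (hb : 0 ≤ b) : a / (a + b) ∈ Icc (0 : ℝ) 1 :=
  ⟨div_nonneg ha (add_nonneg ha hb), div_le_one_of_le₀ (by linarith) (add_nonneg ha hb)⟩

theorem fPrior_matusita {π t : ℝ} (hπ : π ∈ Ioo (0 : ℝ) 1) (ht : 0 ≤ t) :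
    matusita.fPrior π t = 2 * √(π * (1 - π)) * (1 - √t) := by
  have h1 : 0 < 1 - π := sub_pos.2 hπ.2
  have ha : 0 ≤ π * t := mul_nonneg hπ.1.le ht
  rw [Loss.fPrior, matusita_bayesRisk ⟨hπ.1.le, hπ.2.le⟩, add_sub_assoc,
    matusita_bayesRisk (ratio_mem_Icc ha h1.le), add_mul_two_sqrt_ratio ha h1.le,
    show π * t * (1 - π) = π * (1 - π) * t by ring, Real.sqrt_mul (mul_pos hπ.1 h1).le]
  ring

theorem perspective_matusita {π z : ℝ} (hπ : π ∈ Ioo (0 : ℝ) 1) (hz : 0 ≤ z) :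
    perspective (fun z => z + (1 - π) / π) (fun u => -matusita.bayesRisk u) z =
      -(2 * √((1 - π) / π) * √z) := by
  have hb : 0 ≤ (1 - π) / π := div_nonneg (sub_pos.2 hπ.2).le hπ.1.le
  simp only [perspective]
  rw [matusita_bayesRisk (ratio_mem_Icc hz hb), mul_neg, add_mul_two_sqrt_ratio hz hb,
    mul_comm z, Real.sqrt_mul hb]
  ring

/-- The generator is -2k√z with k = √((1-π)/π), so for fixed q the divergence is affine in p apart
from the term √p. This is what permits exact integration over a leaf, where q is constant. At q = 0
the condition p = 0 makes both sides vanish, whatever the value of `deriv` there. -/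
theorem bregman_matusita {π p q : ℝ} (hπ : π ∈ Ioo (0 : ℝ) 1) (hp : 0 ≤ p) (hq : 0 ≤ q)
    (hpq : q = 0 → p = 0) :
    bregman (perspective (fun z => z + (1 - π) / π) (fun u => -matusita.bayesRisk u)) p q =
      √((1 - π) / π) * (√q + p / √q - 2 * √p) := by
  rcases hq.eq_or_lt with rfl | hq
  · simp [bregman, hpq rfl]
  have hd : HasDerivAt
      (perspective (fun z => z + (1 - π) / π) (fun u => -matusita.bayesRisk u))
      (-(2 * √((1 - π) / π) * (1 / (2 * √q)))) q := by
    refine (((Real.hasDerivAt_sqrt hq.ne').const_mul _).neg).congr_of_eventuallyEq ?_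
    filter_upwards [lt_mem_nhds hq] with z hz
    exact perspective_matusita hπ hz.le
  rw [bregman, hd.deriv, perspective_matusita hπ hp, perspective_matusita hπ hq.le]
  have a := Real.sqrt_pos.2 hq
  have e := Real.sq_sqrt hq.le
  field_simp
  linear_combination √((1 - π) / π) * e

/-- The Bhattacharyya affinity of two Bernoulli laws whose parameters differ by at least `2 δ`. -/
theorem bernoulli_affinity_le {a₀ a₁ b₀ b₁ δ : ℝ} (ha₀ : 0 ≤ a₀) (ha₁ : 0 ≤ a₁) (hb₀ : 0 ≤ b₀)
    (hb₁ : 0 ≤ b₁) (ha : a₀ + a₁ = 1) (hb : b₀ + b₁ = 1) (hδ : 0 ≤ δ) (h : 2 * δ ≤ a₁ - b₁) :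
    √(a₀ * b₀) + √(a₁ * b₁) ≤ 1 - 2 * δ ^ 2 := by
  rw [Real.sqrt_mul ha₀, Real.sqrt_mul ha₁]
  have x₀ := Real.sq_sqrt ha₀
  have x₁ := Real.sq_sqrt ha₁
  have y₀ := Real.sq_sqrt hb₀
  have y₁ := Real.sq_sqrt hb₁
  have n₀ := Real.sqrt_nonneg a₀
  have n₁ := Real.sqrt_nonneg a₁
  have m₀ := Real.sqrt_nonneg b₀
  have m₁ := Real.sqrt_nonneg b₁
  generalize √a₀ = s₀ at *
  generalize √a₁ = s₁ at *
  generalize √b₀ = t₀ at *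
  generalize √b₁ = t₁ at *
  subst x₀ x₁ y₀ y₁
  -- The square roots form unit vectors (cos α, sin α) and (cos β, sin β): C = cos(α-β), D =
  -- sin(α-β), S = sin(α+β), and sin²α - sin²β = D S. As S ≤ 1, the gap 2δ bounds D from below, and
  -- C ≤ (1 + C²)/2 concludes.
  set D := s₁ * t₀ - t₁ * s₀ with hD
  set S := s₁ * t₀ + t₁ * s₀ with hS
  set C := s₀ * t₀ + s₁ * t₁ with hC
  have hDC : D ^ 2 + C ^ 2 = 1 := by
    linear_combination (t₀ ^ 2 + t₁ ^ 2) * ha + hb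
  have hDS : s₁ ^ 2 - t₁ ^ 2 = D * S := by
    linear_combination (-s₁ ^ 2) * hb + t₁ ^ 2 * ha
  have hS1 : S ≤ 1 := by nlinarith [sq_nonneg (s₁ - t₀), sq_nonneg (t₁ - s₀)]
  have hS0 : 0 ≤ S := by positivity
  have hC0 : 0 ≤ C := by positivity
  have hS2 : S ^ 2 ≤ 1 := pow_le_one₀ hS0 hS1
  have h4 : (2 * δ) ^ 2 ≤ D ^ 2 := by
    calc (2 * δ) ^ 2 ≤ (D * S) ^ 2 := pow_le_pow_left₀ (by positivity) (hDS ▸ h) 2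
      _ = D ^ 2 * S ^ 2 := mul_pow _ _ _
      _ ≤ D ^ 2 * 1 := by gcongr
      _ = D ^ 2 := mul_one _
  nlinarith [sq_nonneg (C - 1)]

/-! ### Trees and their leaf regions -/

section Trees

variable {X : Type*}

open Classical in
/-- The region of the leaf reached by the observation `x` in a tree rooted at the region `A`. -/
def Tree.leafRegion : Tree X → Set X → X → Set X
  | .leaf, A, _ => A
  | .node s l r, A, x => if x ∈ s then r.leafRegion (A ∩ s) x else l.leafRegion (A \ s) x

/-- All the tests of the tree are measurable. -/
def Tree.MeasurableTests [MeasurableSpace X] : Tree X → Prop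
  | .leaf => True
  | .node s l r => MeasurableSet s ∧ l.MeasurableTests ∧ r.MeasurableTests

theorem Tree.leafRegion_mem (h : Tree X) (A : Set X) (x : X) (hx : x ∈ A) :
    h.leafRegion A x ∈ h.leafRegions A ∧ x ∈ h.leafRegion A x := by
  induction h generalizing A with
  | leaf => simpa [leafRegion, leafRegions] using hx
  | node s l r ihl ihr =>
    by_cases hs : x ∈ s
    · have := ihr (A ∩ s) ⟨hx, hs⟩
      simp [leafRegion, leafRegions, hs, this]
    · have := ihl (A \ s) ⟨hx, hs⟩
      simp [leafRegion, leafRegions, hs, this]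

theorem Tree.exists_split (h : Tree X) (A B s : Set X) (hB : B ∈ h.leafRegions A) :
    ∃ h', h.Split A B s h' := by
  induction h generalizing A with
  | leaf =>
    obtain rfl : B = A := by simpa [leafRegions] using hB
    exact ⟨_, .leaf _ _⟩
  | node t l r ihl ihr =>
    rcases List.mem_append.1 hB with hB | hB
    · obtain ⟨l', hl⟩ := ihl _ hB
      exact ⟨_, .left hl⟩
    · obtain ⟨r', hr⟩ := ihr _ hB
      exact ⟨_, .right hr⟩

theorem Tree.Split.mem_leafRegions {h h' : Tree X} {A B s : Set X} (hs : h.Split A B s h') :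
    B ∈ h.leafRegions A := by
  induction hs with
  | leaf => simp [leafRegions]
  | left _ ih => simp [leafRegions, ih]
  | right _ ih => simp [leafRegions, ih]

theorem Tree.Split.length_leafRegions {h h' : Tree X} {A B s : Set X} (hs : h.Split A B s h') :
    (h'.leafRegions A).length = (h.leafRegions A).length + 1 := by
  induction hs with
  | leaf => simp [leafRegions]
  | left _ ih => simp [leafRegions, ih]; omega
  | right _ ih => simp [leafRegions, ih]; omega

theorem Tree.Split.sum_leafRegions {h h' : Tree X} {A B s : Set X} (hs : h.Split A B s h')
    (w : Set X → ℝ) :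
    ((h'.leafRegions A).map w).sum =
      ((h.leafRegions A).map w).sum - w B + (w (B \ s) + w (B ∩ s)) := by
  induction hs with
  | leaf => simp [leafRegions]
  | left _ ih => simp [leafRegions, ih]; ring
  | right _ ih => simp [leafRegions, ih]; ring

variable [MeasurableSpace X]

theorem Tree.Split.measurableTests {h h' : Tree X} {A B s : Set X} (hs : h.Split A B s h')
    (hh : h.MeasurableTests) (ms : MeasurableSet s) : h'.MeasurableTests := by
  induction hs with
  | leaf => exact ⟨ms, trivial, trivial⟩
  | left _ ih => exact ⟨hh.1, ih hh.2.1 ms, hh.2.2⟩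
  | right _ ih => exact ⟨hh.1, hh.2.1, ih hh.2.2 ms⟩

theorem Tree.MeasurableTests.leafRegions {h : Tree X} (hh : h.MeasurableTests) {A B : Set X}
    (hA : MeasurableSet A) (hB : B ∈ h.leafRegions A) : MeasurableSet B := by
  induction h generalizing A with
  | leaf =>
    obtain rfl : B = A := by simpa [Tree.leafRegions] using hB
    exact hA
  | node t l r ihl ihr =>
    rcases List.mem_append.1 hB with hB | hB
    · exact ihl hh.2.1 (hA.diff hh.1) hB
    · exact ihr hh.2.2 (hA.inter hh.1) hB

theorem Tree.MeasurableTests.measurable_leafRegion {β : Type*} [MeasurableSpace β] {h : Tree X}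
    (hh : h.MeasurableTests) (A : Set X) (φ : Set X → β) :
    Measurable fun x => φ (h.leafRegion A x) := by
  induction h generalizing A with
  | leaf => simpa only [leafRegion] using measurable_const
  | node t l r ihl ihr =>
    simp only [leafRegion, apply_ite φ]
    exact Measurable.ite hh.1 (ihr hh.2.2 _) (ihl hh.2.1 _)

/-- The leaf regions partition A. The integrand may depend on the point as well as on its leaf,
because the Bregman divergence involves dP/dU; the tree risk only needs integrands constant on
leaves. -/
theorem Tree.MeasurableTests.integral_leafRegion {μ : Measure X} {f : Set X → X → ℝ} {h : Tree X}
    (hh : h.MeasurableTests) {A : Set X} (hA : MeasurableSet A)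
    (hf : ∀ B ∈ h.leafRegions A, IntegrableOn (f B) B μ) :
    IntegrableOn (fun x => f (h.leafRegion A x) x) A μ ∧
      ∫ x in A, f (h.leafRegion A x) x ∂μ =
        ((h.leafRegions A).map fun B => ∫ x in B, f B x ∂μ).sum := by
  induction h generalizing A with
  | leaf => simpa [leafRegion, Tree.leafRegions] using hf
  | node t l r ihl ihr =>
    obtain ⟨il, el⟩ := ihl hh.2.1 (hA.diff hh.1)
      fun B hB => hf B (List.mem_append.2 (Or.inl hB))
    obtain ⟨ir, er⟩ := ihr hh.2.2 (hA.inter hh.1)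
      fun B hB => hf B (List.mem_append.2 (Or.inr hB))
    have cl : EqOn (fun x => f ((Tree.node t l r).leafRegion A x) x)
        (fun x => f (l.leafRegion (A \ t) x) x) (A \ t) := fun x hx => by
      simp [leafRegion, hx.2]
    have cr : EqOn (fun x => f ((Tree.node t l r).leafRegion A x) x)
        (fun x => f (r.leafRegion (A ∩ t) x) x) (A ∩ t) := fun x hx => by
      simp [leafRegion, hx.2]
    have jl := il.congr_fun cl.symm (hA.diff hh.1)
    have jr := ir.congr_fun cr.symm (hA.inter hh.1)
    have j := jl.union jr
    rw [sdiff_union_inter] at j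
    refine ⟨j, ?_⟩
    rw [← integral_inter_add_sdiff hh.1 j, setIntegral_congr_fun (hA.inter hh.1) cr,
      setIntegral_congr_fun (hA.diff hh.1) cl, el, er, Tree.leafRegions, List.map_append,
      List.sum_append, add_comm]

theorem Tree.posterior_eq_leafRegion (π : ℝ) (P U : Measure X) (h : Tree X) (A : Set X) (x : X) :
    h.posterior π P U A x =
      π * P.real (h.leafRegion A x) / (mixture π P U).real (h.leafRegion A x) := by
  induction h generalizing A with
  | leaf => rfl
  | node s l r ihl ihr =>
    by_cases hs : x ∈ s
    · simp [leafRegion, posterior, hs, ihr]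
    · simp [leafRegion, posterior, hs, ihl]

/-- The law of the copycat generator, scaled by the `P`-mass of the root region, has the density
`P(B) / U(B)` on each leaf region `B`. -/
theorem Tree.MeasurableTests.smul_law_copycat {P U : Measure X} [IsProbabilityMeasure P]
    {h : Tree X} (hh : h.MeasurableTests) {A : Set X} (hA : MeasurableSet A) :
    P A • (h.copycat P A).law U A =
      (U.restrict A).withDensity fun x => P (h.leafRegion A x) / U (h.leafRegion A x) := by
  induction h generalizing A with
  | leaf =>
    simp only [copycat, GenTree.law, leafRegion, withDensity_const, ProbabilityTheory.cond,
      smul_smul, div_eq_mul_inv]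
  | node s l r ihl ihr =>
    have hAs := measureReal_sdiff_add_inter (μ := P) (s := A) hh.1
    -- Scaling by P(A) keeps the induction valid on null regions: there `splitProb` is 0/0 = 0, so
    -- the left arc gets probability 1, but both scaled masses vanish.
    have key : ∀ {B : Set X} {c : ℝ}, B ⊆ A → (P.real A ≠ 0 → c = P.real B / P.real A) →
        P A * ENNReal.ofReal c = P B := by
      intro B c hB hc
      rcases eq_or_ne (P.real A) 0 with h0 | h0
      · have h0' : P A = 0 := (measureReal_eq_zero_iff).1 h0
        rw [h0', measure_mono_null hB h0', zero_mul]
      · rw [hc h0, ← ofReal_measureReal (μ := P) (s := A), ← ENNReal.ofReal_mul measureReal_nonneg,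
          mul_div_cancel₀ _ h0, ofReal_measureReal]
    have el : P A * ENNReal.ofReal (1 - (splitProb P A s : ℝ)) = P (A \ s) := by
      refine key sdiff_subset fun h0 => ?_
      rw [splitProb]
      field_simp
      linarith
    have er : P A * ENNReal.ofReal (splitProb P A s : ℝ) = P (A ∩ s) :=
      key inter_subset_left fun _ => rfl
    simp only [copycat, GenTree.law]
    rw [smul_add, smul_smul, smul_smul, el, er, ihl hh.2.1 (hA.diff hh.1),
      ihr hh.2.2 (hA.inter hh.1), ← Measure.restrict_inter_add_sdiff (μ := U) A hh.1,
      withDensity_add_measure, add_comm]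
    congr 1
    · refine withDensity_congr_ae ((ae_restrict_iff' (hA.inter hh.1)).2 (.of_forall fun x hx => ?_))
      simp [leafRegion, hx.2]
    · refine withDensity_congr_ae ((ae_restrict_iff' (hA.diff hh.1)).2 (.of_forall fun x hx => ?_))
      simp [leafRegion, hx.2]

theorem copycatMeasure_eq_withDensity (P U : Measure X) [IsProbabilityMeasure P]
    {h : Tree X} (hh : h.MeasurableTests) :
    copycatMeasure P U h =
      U.withDensity fun x => P (h.leafRegion univ x) / U (h.leafRegion univ x) := by
  simpa [copycatMeasure] using hh.smul_law_copycat (P := P) (U := U) MeasurableSet.univ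

end Trees

/-! ### Risks and divergences as Bhattacharyya affinities -/

section Risks

variable {X : Type*} [MeasurableSpace X]

/-- The weight `√(P(B) U(B))` of a region `B`. -/
def regionWeight (P U : Measure X) (B : Set X) : ℝ := √(P.real B * U.real B)

/-- The Bhattacharyya affinity of `P` and `U`, after restriction to the leaves of the tree `h`. -/
def Tree.affinity (P U : Measure X) (h : Tree X) : ℝ :=
  ((h.leafRegions univ).map (regionWeight P U)).sum

/-- The Bhattacharyya affinity `∫ √(dP/dU) dU` (for `P ≪ U`). -/
def bhattacharyya (P U : Measure X) : ℝ :=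
  ∫ x, √(P.rnDeriv U x).toReal ∂U

variable {P U : Measure X} {π : ℝ}

theorem mixture_absolutelyContinuous (hPU : P ≪ U) : mixture π P U ≪ U :=
  (hPU.smul_left _).add_left (Measure.AbsolutelyContinuous.rfl.smul_left _)

theorem absolutelyContinuous_mixture (hπ : π ∈ Ioo (0 : ℝ) 1) : P ≪ mixture π P U := by
  refine Measure.AbsolutelyContinuous.mk fun s _ hs => ?_
  simp only [mixture, Measure.add_apply, Measure.smul_apply, smul_eq_mul, add_eq_zero,
    mul_eq_zero, ENNReal.ofReal_eq_zero, not_le.2 hπ.1, false_or] at hs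
  exact hs.1

variable [IsProbabilityMeasure P] [IsProbabilityMeasure U]

theorem mixture_real (hπ : π ∈ Ioo (0 : ℝ) 1) (B : Set X) :
    (mixture π P U).real B = π * P.real B + (1 - π) * U.real B := by
  have h1 : 0 < 1 - π := sub_pos.2 hπ.2
  simp only [mixture, measureReal_def, Measure.add_apply, Measure.smul_apply, smul_eq_mul]
  rw [ENNReal.toReal_add (by finiteness) (by finiteness), ENNReal.toReal_mul, ENNReal.toReal_mul,
    ENNReal.toReal_ofReal hπ.1.le, ENNReal.toReal_ofReal h1.le]

instance isFiniteMeasure_mixture : IsFiniteMeasure (mixture π P U) := by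
  refine ⟨?_⟩
  simp only [mixture, Measure.add_apply, Measure.smul_apply, smul_eq_mul]
  finiteness

theorem integrable_sqrt_rnDeriv : Integrable (fun x => √(P.rnDeriv U x).toReal) U := by
  refine ((integrable_const (1 : ℝ)).add (Measure.integrable_toReal_rnDeriv (μ := P))).mono'
    (Measure.measurable_rnDeriv P U).ennreal_toReal.sqrt.aestronglyMeasurable
    (.of_forall fun x => ?_)
  have h0 : 0 ≤ (P.rnDeriv U x).toReal := ENNReal.toReal_nonneg
  rw [Real.norm_of_nonneg (Real.sqrt_nonneg _)]
  simp only [Pi.add_apply]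
  nlinarith [Real.sq_sqrt h0, sq_nonneg (√(P.rnDeriv U x).toReal - 1)]

/-- A zero affinity would force dP/dU = 0 almost everywhere, contradicting P ≪ U and total mass 1.
It keeps the risk level positive when ε = 0. -/
theorem bhattacharyya_pos (hPU : P ≪ U) : 0 < bhattacharyya P U := by
  refine (integral_nonneg fun x => Real.sqrt_nonneg _).lt_of_ne' fun h0 => ?_
  rw [integral_eq_zero_iff_of_nonneg (fun x => Real.sqrt_nonneg _) integrable_sqrt_rnDeriv] at h0
  have h1 : P.rnDeriv U =ᵐ[U] 0 := by
    filter_upwards [h0, P.rnDeriv_lt_top U] with x hx hlt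
    have := (Real.sqrt_eq_zero ENNReal.toReal_nonneg).1 hx
    simpa [ENNReal.toReal_eq_zero_iff, hlt.ne] using this
  have h2 := Measure.lintegral_rnDeriv hPU
  rw [lintegral_congr_ae h1] at h2
  simp at h2

theorem bhattacharyya_le_one (hPU : P ≪ U) : bhattacharyya P U ≤ 1 := by
  have hi := (integrable_const (μ := U) (1 : ℝ)).add
    (Measure.integrable_toReal_rnDeriv (μ := P) (ν := U))
  have h : bhattacharyya P U ≤ ∫ x, (1 / 2 : ℝ) * (1 + (P.rnDeriv U x).toReal) ∂U := by
    refine integral_mono integrable_sqrt_rnDeriv (hi.const_mul _) fun x => ?_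
    have h0 : 0 ≤ (P.rnDeriv U x).toReal := ENNReal.toReal_nonneg
    beta_reduce
    nlinarith [Real.sq_sqrt h0, sq_nonneg (√(P.rnDeriv U x).toReal - 1)]
  rw [integral_const_mul, integral_add (integrable_const _) Measure.integrable_toReal_rnDeriv,
    Measure.integral_toReal_rnDeriv hPU] at h
  norm_num at h
  exact h

theorem fDivergence_fPrior (hπ : π ∈ Ioo (0 : ℝ) 1) :
    fDivergence (matusita.fPrior π) P U = 2 * √(π * (1 - π)) * (1 - bhattacharyya P U) := by
  simp only [fDivergence, fPrior_matusita hπ ENNReal.toReal_nonneg]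
  rw [integral_const_mul, integral_sub (integrable_const _) integrable_sqrt_rnDeriv]
  simp [bhattacharyya]

/-- If `v` takes its values in `[0, 1]`, then its full risk against itself is the integral of
the Bayes risk. -/
theorem popRisk_self {v : X → ℝ} {M : Measure X} (hv : ∀ᵐ x ∂M, v x ∈ Icc (0 : ℝ) 1)
    (hm : AEStronglyMeasurable (fun x => 2 * √(v x * (1 - v x))) M) :
    matusita.popRisk v v M = ∫ x, 2 * √(v x * (1 - v x)) ∂M := by
  rw [integral_eq_lintegral_of_nonneg_ae (.of_forall fun x => by positivity) hm, Loss.popRisk]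
  congr 1
  exact lintegral_congr_ae (hv.mono fun x hx => matusita_pointRisk_self hx)

/-- Change of measure to U: with p = dP/dU, dM/dU = πp + (1-π), and the chain rule for densities
gives η⋆ = πp/(πp + (1-π)). The denominator cancels in the scaled Bayes risk. -/
theorem popRisk_bayesPosterior (hπ : π ∈ Ioo (0 : ℝ) 1) (hPU : P ≪ U) :
    matusita.popRisk (bayesPosterior π P U) (bayesPosterior π P U) (mixture π P U) =
      2 * √(π * (1 - π)) * bhattacharyya P U := by
  have h1 : 0 < 1 - π := sub_pos.2 hπ.2
  have hMU : mixture π P U ≪ U := mixture_absolutelyContinuous hPU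
  have hfin : ∀ (a : ℝ) (μ : Measure X) [IsFiniteMeasure μ],
      IsFiniteMeasure (ENNReal.ofReal a • μ) :=
    fun a μ _ => μ.smul_finite ENNReal.ofReal_ne_top
  have := hfin π P
  have := hfin (1 - π) U
  have hM : ∀ᵐ x ∂U, ((mixture π P U).rnDeriv U x).toReal =
      π * (P.rnDeriv U x).toReal + (1 - π) := by
    filter_upwards [Measure.rnDeriv_add' (ENNReal.ofReal π • P) (ENNReal.ofReal (1 - π) • U) U,
      Measure.rnDeriv_smul_left_of_ne_top P U (ENNReal.ofReal_ne_top (r := π)),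
      Measure.rnDeriv_smul_left_of_ne_top U U (ENNReal.ofReal_ne_top (r := 1 - π)),
      Measure.rnDeriv_self U, P.rnDeriv_lt_top U] with x e1 e2 e3 e4 e5
    rw [mixture, e1, Pi.add_apply, e2, e3, Pi.smul_apply, Pi.smul_apply, e4, smul_eq_mul,
      smul_eq_mul, mul_one, ENNReal.toReal_add (ENNReal.mul_ne_top ENNReal.ofReal_ne_top e5.ne)
        ENNReal.ofReal_ne_top, ENNReal.toReal_mul, ENNReal.toReal_ofReal hπ.1.le,
      ENNReal.toReal_ofReal h1.le]
  have hη : ∀ᵐ x ∂U, bayesPosterior π P U x =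
      π * (P.rnDeriv U x).toReal / (π * (P.rnDeriv U x).toReal + (1 - π)) := by
    filter_upwards [hM, Measure.rnDeriv_mul_rnDeriv (κ := U)
      (absolutelyContinuous_mixture (P := P) (U := U) hπ)] with x e1 e2
    have hp : 0 ≤ (P.rnDeriv U x).toReal := ENNReal.toReal_nonneg
    have hpos : 0 < π * (P.rnDeriv U x).toReal + (1 - π) := by
      have := mul_nonneg hπ.1.le hp
      linarith
    rw [eq_div_iff hpos.ne', ← e1, ← e2, bayesPosterior, Pi.mul_apply, ENNReal.toReal_mul]
    ring
  have hmem : ∀ᵐ x ∂(mixture π P U), bayesPosterior π P U x ∈ Icc (0 : ℝ) 1 := by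
    refine hMU.ae_le (hη.mono fun x hx => ?_)
    rw [hx]
    exact ratio_mem_Icc (mul_nonneg hπ.1.le ENNReal.toReal_nonneg) h1.le
  have hmeas : Measurable (bayesPosterior π P U) :=
    (Measure.measurable_rnDeriv _ _).ennreal_toReal.const_mul π
  rw [popRisk_self hmem (by fun_prop), ← integral_rnDeriv_smul hMU, bhattacharyya,
    ← integral_const_mul]
  refine integral_congr_ae ?_
  filter_upwards [hM, hη] with x e1 e2
  rw [e1, e2, smul_eq_mul,
    add_mul_two_sqrt_ratio (mul_nonneg hπ.1.le ENNReal.toReal_nonneg) h1.le,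
    mul_right_comm π, Real.sqrt_mul (mul_pos hπ.1 h1).le, mul_assoc]

theorem riskLevel_matusita (hπ : π ∈ Ioo (0 : ℝ) 1) (hPU : P ≪ U) (ε : ℝ) :
    matusita.riskLevel ε π P U =
      2 * √(π * (1 - π)) * (ε + (1 - ε) * bhattacharyya P U) := by
  rw [Loss.riskLevel, popRisk_bayesPosterior hπ hPU, matusita_bayesRisk ⟨hπ.1.le, hπ.2.le⟩]
  ring

theorem Tree.MeasurableTests.risk_eq {h : Tree X} (hh : h.MeasurableTests)
    (hπ : π ∈ Ioo (0 : ℝ) 1) :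
    h.risk matusita π P U = 2 * √(π * (1 - π)) * h.affinity P U := by
  have h1 : 0 < 1 - π := sub_pos.2 hπ.2
  have ha : ∀ B : Set X, 0 ≤ π * P.real B := fun B => mul_nonneg hπ.1.le measureReal_nonneg
  have hb : ∀ B : Set X, 0 ≤ (1 - π) * U.real B := fun B => mul_nonneg h1.le measureReal_nonneg
  have hpost : h.posterior π P U univ = fun x => (fun B : Set X => π * P.real B /
      (π * P.real B + (1 - π) * U.real B)) (h.leafRegion univ x) := by
    funext x
    rw [posterior_eq_leafRegion, mixture_real hπ]
  have hmeas : Measurable (h.posterior π P U univ) := by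
    rw [hpost]
    exact hh.measurable_leafRegion univ fun B : Set X => π * P.real B /
      (π * P.real B + (1 - π) * U.real B)
  rw [risk, popRisk_self (.of_forall fun x => by
    rw [hpost]; exact ratio_mem_Icc (ha _) (hb _)) (by fun_prop), hpost]
  have := (hh.integral_leafRegion (μ := mixture π P U) (A := univ) (f := fun B _ =>
    2 * √(π * P.real B / (π * P.real B + (1 - π) * U.real B) *
      (1 - π * P.real B / (π * P.real B + (1 - π) * U.real B))))
    MeasurableSet.univ fun B _ => integrable_const _).2
  rw [setIntegral_univ] at this
  rw [this, affinity, ← List.sum_map_mul_left]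
  congr 2
  funext B
  rw [setIntegral_const, smul_eq_mul, mixture_real hπ, add_mul_two_sqrt_ratio (ha B) (hb B),
    show π * P.real B * ((1 - π) * U.real B) = π * (1 - π) * (P.real B * U.real B) by ring,
    Real.sqrt_mul (mul_pos hπ.1 h1).le, mul_assoc, regionWeight]

/-- These are the integrals over B of √q and (dP/dU)/√q for q = P(B)/U(B). Absolute continuity
handles U(B) = 0, where q is 0 by convention. -/
theorem regionWeight_eq_sqrt_div_mul (hPU : P ≪ U) (B : Set X) :
    √(P.real B / U.real B) * U.real B = regionWeight P U B ∧
      P.real B / √(P.real B / U.real B) = regionWeight P U B := by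
  have hp : 0 ≤ P.real B := measureReal_nonneg
  have hu : 0 ≤ U.real B := measureReal_nonneg
  rw [regionWeight]
  rcases hu.eq_or_lt with h0 | hu
  · have hP : P.real B = 0 := by
      rw [measureReal_eq_zero_iff]
      exact hPU ((measureReal_eq_zero_iff (by finiteness)).1 h0.symm)
    simp [← h0, hP]
  rcases hp.eq_or_lt with h0 | hp
  · simp [← h0]
  have a := Real.sqrt_pos.2 hu
  have b := Real.sqrt_pos.2 hp
  have a2 := Real.sq_sqrt hu.le
  have b2 := Real.sq_sqrt hp.le
  rw [Real.sqrt_div hp.le, Real.sqrt_mul hp.le]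
  generalize √(P.real B) = s at *
  generalize √(U.real B) = t at *
  rw [← a2, ← b2]
  constructor <;> field_simp

theorem Tree.MeasurableTests.likelihoodRatioRisk_copycat {h : Tree X} (hh : h.MeasurableTests)
    (hπ : π ∈ Ioo (0 : ℝ) 1) (hPU : P ≪ U) :
    Integrable (matusita.ratioDivergence π P (copycatMeasure P U h) U) U ∧
      matusita.likelihoodRatioRisk π P (copycatMeasure P U h) U =
        2 * √(π * (1 - π)) * (h.affinity P U - bhattacharyya P U) := by
  have h1 : 0 < 1 - π := sub_pos.2 hπ.2
  set q : Set X → ℝ := fun B => P.real B / U.real B with hq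
  set p : X → ℝ := fun x => (P.rnDeriv U x).toReal with hp
  have hpi : Integrable p U := Measure.integrable_toReal_rnDeriv
  have hG : ∀ᵐ x ∂U, ((copycatMeasure P U h).rnDeriv U x).toReal = q (h.leafRegion univ x) := by
    rw [copycatMeasure_eq_withDensity P U hh]
    filter_upwards [Measure.rnDeriv_withDensity U
      (hh.measurable_leafRegion univ fun B => P B / U B)] with x hx
    rw [hx, ENNReal.toReal_div]
    rfl
  -- The condition required by `bregman_matusita`: a leaf with q = 0 is P-null (through P ≪ U if
  -- U(B) = 0), so dP/dU vanishes almost everywhere on it. There are finitely many leaves, so the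
  -- exceptional sets stay null together.
  have hnull : ∀ᵐ x ∂U, q (h.leafRegion univ x) = 0 → p x = 0 := by
    have : ∀ᵐ x ∂U, ∀ B ∈ {B | B ∈ h.leafRegions univ}, x ∈ B → q B = 0 → p x = 0 := by
      rw [ae_ball_iff (List.finite_toSet _).countable]
      intro B hB
      have mB := hh.leafRegions MeasurableSet.univ hB
      by_cases h0 : q B = 0
      · have hPB : P.real B = 0 := by
          rcases div_eq_zero_iff.1 h0 with h0 | h0
          · exact h0
          · rw [measureReal_eq_zero_iff] at h0 ⊢
            exact hPU h0
        rw [← Measure.setIntegral_toReal_rnDeriv hPU, integral_eq_zero_iff_of_nonneg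
          (fun x => ENNReal.toReal_nonneg) hpi.integrableOn, Filter.EventuallyEq,
          ae_restrict_iff' mB] at hPB
        exact hPB.mono fun x hx hxB _ => hx hxB
      · exact .of_forall fun x _ h0' => absurd h0' h0
    filter_upwards [this] with x hx
    have hm := h.leafRegion_mem univ x trivial
    exact hx _ hm.1 hm.2
  have hae : matusita.ratioDivergence π P (copycatMeasure P U h) U =ᵐ[U] fun x =>
      √((1 - π) / π) * ((√(q (h.leafRegion univ x)) + p x / √(q (h.leafRegion univ x))) -
        2 * √(p x)) := by
    filter_upwards [hG, hnull] with x e1 e2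
    rw [Loss.ratioDivergence, e1]
    exact bregman_matusita hπ ENNReal.toReal_nonneg
      (div_nonneg measureReal_nonneg measureReal_nonneg) e2
  obtain ⟨hi, he⟩ := hh.integral_leafRegion (μ := U) (A := univ)
    (f := fun B x => √(q B) + p x / √(q B)) MeasurableSet.univ
    fun B _ => ((integrable_const _).add (hpi.div_const _)).integrableOn
  rw [integrableOn_univ] at hi
  rw [setIntegral_univ] at he
  have hs : Integrable (fun x => 2 * √(p x)) U := integrable_sqrt_rnDeriv.const_mul 2
  refine ⟨((hi.sub hs).const_mul _).congr hae.symm, ?_⟩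
  have hw : ∀ B : Set X, ∫ x in B, √(q B) + p x / √(q B) ∂U = 2 * regionWeight P U B := by
    intro B
    have hB := regionWeight_eq_sqrt_div_mul hPU B
    rw [integral_add (integrable_const _) (hpi.div_const _).integrableOn, setIntegral_const,
      integral_div, Measure.setIntegral_toReal_rnDeriv hPU, smul_eq_mul, mul_comm, hB.1, hB.2,
      two_mul]
  have hk : π * √((1 - π) / π) = √(π * (1 - π)) := by
    rw [show π * (1 - π) = π ^ 2 * ((1 - π) / π) by have := hπ.1.ne'; field_simp,
      Real.sqrt_mul (sq_nonneg π), Real.sqrt_sq hπ.1.le]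
  rw [Loss.likelihoodRatioRisk, integral_congr_ae hae, integral_const_mul, integral_sub hi hs, he,
    integral_const_mul, ← mul_assoc, hk]
  simp only [hw, List.sum_map_mul_left]
  rw [Tree.affinity, bhattacharyya]
  ring

/-- Conditioned on B, the test has a Bernoulli law under P and under U, and the WHA says exactly
that their parameters differ by at least 2δ. The ratio of the split weight to the old one is the
affinity of these two laws. -/
theorem WeakHypothesis.regionWeight_split_le {δ : ℝ} (hδ : 0 ≤ δ) (hPU : P ≪ U) {B s : Set X}
    (hB : MeasurableSet B) (hs : MeasurableSet s) (hPB : P B ≠ 0)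
    (hw : WeakHypothesis δ P U B s) :
    regionWeight P U (B \ s) + regionWeight P U (B ∩ s) ≤
      (1 - 2 * δ ^ 2) * regionWeight P U B := by
  have hUB : U B ≠ 0 := fun h0 => hPB (hPU h0)
  have hp : 0 < P.real B := measureReal_nonneg.lt_of_ne' (by simpa [measureReal_eq_zero_iff])
  have hu : 0 < U.real B := measureReal_nonneg.lt_of_ne' (by simpa [measureReal_eq_zero_iff])
  have hPs := measureReal_sdiff_add_inter (μ := P) (s := B) hs
  have hUs := measureReal_sdiff_add_inter (μ := U) (s := B) hs
  have hcond : ∀ (μ : Measure X) (t : Set X), (μ[|B]).real t = μ.real (B ∩ t) / μ.real B := by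
    intro μ t
    rw [measureReal_def, ProbabilityTheory.cond_apply hB, ENNReal.toReal_mul, ENNReal.toReal_inv,
      measureReal_def, measureReal_def, div_eq_inv_mul]
  rw [WeakHypothesis, balancedError, hcond, hcond, ← sdiff_eq] at hw
  have ea : P.real (B \ s) / P.real B + P.real (B ∩ s) / P.real B = 1 := by
    rw [← add_div, hPs, div_self hp.ne']
  have eb : U.real (B \ s) / U.real B + U.real (B ∩ s) / U.real B = 1 := by
    rw [← add_div, hUs, div_self hu.ne']
  have key := bernoulli_affinity_le (div_nonneg measureReal_nonneg hp.le)
    (div_nonneg measureReal_nonneg hp.le) (div_nonneg measureReal_nonneg hu.le)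
    (div_nonneg measureReal_nonneg hu.le) ea eb hδ (by linarith)
  have hmul : ∀ C : Set X, √(P.real C / P.real B * (U.real C / U.real B)) * regionWeight P U B =
      regionWeight P U C := by
    intro C
    rw [regionWeight, regionWeight, ← Real.sqrt_mul' _ (mul_pos hp hu).le]
    congr 1
    field_simp
  have := mul_le_mul_of_nonneg_right key (Real.sqrt_nonneg (P.real B * U.real B))
  rwa [← regionWeight, add_mul, hmul, hmul] at this

end Risks

/-! ### Convergence of greedy top-down induction -/

section TopDown

variable {X : Type*} [MeasurableSpace X] {P U : Measure X} {π : ℝ}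

theorem Tree.affinity_nonneg (h : Tree X) : 0 ≤ h.affinity P U := by
  refine List.sum_nonneg fun C hC => ?_
  obtain ⟨D, -, rfl⟩ := List.mem_map.1 hC
  exact Real.sqrt_nonneg _

/-- Some leaf carries at least the average weight. -/
theorem Tree.exists_affinity_le (h : Tree X) (hn : h.leafRegions univ ≠ []) :
    ∃ B ∈ h.leafRegions univ,
      h.affinity P U / (h.leafRegions univ).length ≤ regionWeight P U B := by
  refine List.exists_le_of_sum_le hn
    (fun _ => h.affinity P U / (h.leafRegions univ).length) _ ?_
  have h0 : ((h.leafRegions univ).length : ℝ) ≠ 0 := by simpa using hn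
  rw [List.map_const', List.sum_replicate, nsmul_eq_mul, mul_div_cancel₀ _ h0, affinity]

variable [IsProbabilityMeasure P] [IsProbabilityMeasure U]

theorem regionWeight_mono {A B : Set X} (h : A ⊆ B) : regionWeight P U A ≤ regionWeight P U B :=
  Real.sqrt_le_sqrt (mul_le_mul (measureReal_mono h) (measureReal_mono h) measureReal_nonneg
    measureReal_nonneg)

theorem Tree.affinity_leaf : (Tree.leaf : Tree X).affinity P U = 1 := by
  simp [affinity, leafRegions, regionWeight]

theorem TopDownStep.affinity_le {F : Set X → Set (Set X)} {h h' : Tree X}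
    (hst : TopDownStep matusita π P U F h h') (hF : ∀ B, ∀ s ∈ F B, MeasurableSet s)
    (hh : h.MeasurableTests) (hn : h.leafRegions univ ≠ []) (hπ : π ∈ Ioo (0 : ℝ) 1) (hPU : P ≪ U)
    {δ : ℝ} (hδ : 0 ≤ δ)
    (hwha : ∀ B ∈ h.leafRegions univ, P B ≠ 0 → ∃ s ∈ F B, WeakHypothesis δ P U B s) :
    h'.affinity P U ≤ (1 - 2 * δ ^ 2 / (h.leafRegions univ).length) * h.affinity P U := by
  obtain ⟨B', s', hs', hsplit, hmin⟩ := hst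
  obtain ⟨B, hB, hle⟩ := h.exists_affinity_le (P := P) (U := U) hn
  have hlen : (0 : ℝ) < (h.leafRegions univ).length := by
    exact_mod_cast List.length_pos_iff.2 hn
  have hw0 : ∀ C ∈ (h.leafRegions univ).map (regionWeight P U), 0 ≤ C := by
    intro C hC
    obtain ⟨D, -, rfl⟩ := List.mem_map.1 hC
    exact Real.sqrt_nonneg _
  -- The WHA is not available on a P-null leaf. But then at least average weight is zero, so Z(h) =
  -- 0, and no split can make it positive since weights are monotone.
  by_cases hPB : P B = 0
  · have hzero : h.affinity P U = 0 := by
      have hB0 : regionWeight P U B = 0 := by simp [regionWeight, measureReal_def, hPB]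
      rw [hB0, div_le_iff₀ hlen, zero_mul] at hle
      exact hle.antisymm h.affinity_nonneg
    have hzero' : h'.affinity P U ≤ 0 := by
      have e := hsplit.sum_leafRegions (regionWeight P U)
      have hB' : regionWeight P U B' ≤ 0 :=
        hzero ▸ List.single_le_sum hw0 _ (List.mem_map_of_mem hsplit.mem_leafRegions)
      have a := regionWeight_mono (P := P) (U := U) (sdiff_subset (s := B') (t := s'))
      have b := regionWeight_mono (P := P) (U := U) (inter_subset_left (s := B') (t := s'))
      have c : 0 ≤ regionWeight P U (B' \ s') := Real.sqrt_nonneg _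
      rw [Tree.affinity] at hzero ⊢
      linarith
    rw [hzero, mul_zero]
    exact hzero'
  obtain ⟨s, hs, hw⟩ := hwha B hB hPB
  obtain ⟨h'', hsp⟩ := h.exists_split univ B s hB
  have hr := hmin B s h'' hs hsp
  have hc : 0 < 2 * √(π * (1 - π)) :=
    mul_pos two_pos (Real.sqrt_pos.2 (mul_pos hπ.1 (sub_pos.2 hπ.2)))
  rw [(hsplit.measurableTests hh (hF _ _ hs')).risk_eq hπ,
    (hsp.measurableTests hh (hF _ _ hs)).risk_eq hπ, mul_le_mul_iff_right₀ hc] at hr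
  have hdrop := hw.regionWeight_split_le hδ hPU (hh.leafRegions MeasurableSet.univ hB)
    (hF _ _ hs) hPB
  have e := hsp.sum_leafRegions (regionWeight P U)
  rw [← Tree.affinity, ← Tree.affinity] at e
  have := mul_le_mul_of_nonneg_left hle (by positivity : 0 ≤ 2 * δ ^ 2)
  calc h'.affinity P U ≤ h.affinity P U - 2 * δ ^ 2 * regionWeight P U B := by linarith
    _ ≤ h.affinity P U - 2 * δ ^ 2 * (h.affinity P U / (h.leafRegions univ).length) := by linarith
    _ = _ := by ring

/-- The induction step that turns the factors 1 - κ/x into polynomial decay: 1 - κ/x ≤ exp(-κ/x) ≤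
(1 + 1/x)^(-κ). -/
theorem one_sub_div_mul_rpow_neg_le {κ x : ℝ} (hκ : 0 ≤ κ) (hx : 0 < x) :
    (1 - κ / x) * x ^ (-κ) ≤ (x + 1) ^ (-κ) := by
  have h1 : 1 - κ / x ≤ Real.exp (-(κ / x)) := by
    have := Real.add_one_le_exp (-(κ / x))
    linarith
  have h2 : ((x + 1) / x) ^ κ ≤ Real.exp (κ / x) := by
    have : (x + 1) / x ≤ Real.exp (1 / x) := by
      have := Real.add_one_le_exp (1 / x)
      rwa [add_div, div_self hx.ne', add_comm]
    calc ((x + 1) / x) ^ κ ≤ Real.exp (1 / x) ^ κ :=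
          Real.rpow_le_rpow (by positivity) this hκ
      _ = Real.exp (κ / x) := by rw [← Real.exp_mul]; congr 1; ring
  have h3 : Real.exp (-(κ / x)) ≤ ((x + 1) / x) ^ (-κ) := by
    rw [Real.exp_neg, Real.rpow_neg (by positivity)]
    exact inv_anti₀ (by positivity) h2
  calc (1 - κ / x) * x ^ (-κ) ≤ ((x + 1) / x) ^ (-κ) * x ^ (-κ) := by
        gcongr
        exact h1.trans h3
    _ = (x + 1) ^ (-κ) := by
        rw [← Real.mul_rpow (by positivity) hx.le, div_mul_cancel₀ _ hx.ne']

/-- Convergence rate of greedy top-down induction under the Weak Hypothesis Assumption. -/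
theorem affinity_topDown_le {F : Set X → Set (Set X)} (hF : ∀ B, ∀ s ∈ F B, MeasurableSet s)
    (hπ : π ∈ Ioo (0 : ℝ) 1) (hPU : P ≪ U) {δ : ℝ} (hδ : 0 ≤ δ) {T : ℕ} {h : ℕ → Tree X}
    (h_root : h 0 = .leaf) (h_step : ∀ t < T, TopDownStep matusita π P U F (h t) (h (t + 1)))
    (h_wha : ∀ t < T, ∀ B ∈ (h t).leafRegions univ, P B ≠ 0 →
      ∃ s ∈ F B, WeakHypothesis δ P U B s) (t : ℕ) (ht : t ≤ T) :
    (h t).MeasurableTests ∧ ((h t).leafRegions univ).length = t + 1 ∧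
      (h t).affinity P U ≤ ((t : ℝ) + 1) ^ (-(2 * δ ^ 2)) := by
  induction t with
  | zero => simp [h_root, Tree.affinity_leaf, Tree.MeasurableTests, Tree.leafRegions]
  | succ t ih =>
    obtain ⟨hm, hl, ha⟩ := ih (by omega)
    have hst := h_step t (by omega)
    have hn : (h t).leafRegions univ ≠ [] := by
      intro h0
      simp [h0] at hl
    have hle := hst.affinity_le hF hm hn hπ hPU hδ (h_wha t (by omega))
    have hx : (0 : ℝ) < (t : ℝ) + 1 := by positivity
    obtain ⟨B, s, hs, hsp, -⟩ := hst
    refine ⟨hsp.measurableTests hm (hF _ _ hs), by rw [hsp.length_leafRegions, hl], ?_⟩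
    rw [hl] at hle
    push_cast at hle ⊢
    -- A negative factor would reverse the induction bound, but it makes the new affinity
    -- nonpositive at once.
    rcases le_or_gt 0 (1 - 2 * δ ^ 2 / ((t : ℝ) + 1)) with h0 | h0
    · exact (hle.trans (mul_le_mul_of_nonneg_left ha h0)).trans
        (one_sub_div_mul_rpow_neg_le (by positivity) hx)
    · exact (hle.trans (mul_nonpos_of_nonpos_of_nonneg h0.le (h t).affinity_nonneg)).trans
        (by positivity)

end TopDown

end Copycat

end

/-! ### From the decay rate to the bound on the number of splits -/

theorem mainTheorem6 {X : Type*} [MeasurableSpace X]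
    (P U : Measure X) [IsProbabilityMeasure P] [IsProbabilityMeasure U] (hPU : P ≪ U)
    (π : ℝ) (hπ : π ∈ Set.Ioo (0 : ℝ) 1) (δ : ℝ) (hδ : 0 < δ)
    (F : Set X → Set (Set X)) (hF : ∀ B, ∀ s ∈ F B, MeasurableSet s)
    (T : ℕ) (h : ℕ → Copycat.Tree X) (h_root : h 0 = Copycat.Tree.leaf)
    (h_step : ∀ t < T, Copycat.TopDownStep Copycat.matusita π P U F (h t) (h (t + 1)))
    (h_wha : ∀ t < T, ∀ B ∈ (h t).leafRegions Set.univ, P B ≠ 0 →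
      ∃ s ∈ F B, Copycat.WeakHypothesis δ P U B s)
    (ε : ℝ) (hε : ε ∈ Set.Icc (0 : ℝ) 1)
    (hT : (1 / Copycat.matusita.riskLevel ε π P U) ^ (32 / δ ^ 2) ≤ (T : ℝ)) :
    Integrable (Copycat.matusita.ratioDivergence π P (Copycat.copycatMeasure P U (h T)) U) U ∧
    Copycat.matusita.likelihoodRatioRisk π P (Copycat.copycatMeasure P U (h T)) U ≤
      ε * Copycat.fDivergence (Copycat.matusita.fPrior π) P U := by
  obtain ⟨hm, -, ha⟩ := Copycat.affinity_topDown_le hF hπ hPU hδ.le h_root h_step h_wha T le_rfl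
  obtain ⟨hint, hrisk⟩ := hm.likelihoodRatioRisk_copycat hπ hPU
  refine ⟨hint, ?_⟩
  have hH0 := Copycat.bhattacharyya_pos hPU
  have hH1 := Copycat.bhattacharyya_le_one hPU
  rw [hrisk, Copycat.fDivergence_fPrior hπ]
  rw [Copycat.riskLevel_matusita hπ hPU] at hT
  set H := Copycat.bhattacharyya P U with hH
  have hc : 0 < 2 * √(π * (1 - π)) :=
    mul_pos two_pos (Real.sqrt_pos.2 (mul_pos hπ.1 (sub_pos.2 hπ.2)))
  have hc1 : 2 * √(π * (1 - π)) ≤ 1 := by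
    have : √(π * (1 - π)) ≤ 1 / 2 :=
      (Real.sqrt_le_sqrt (by nlinarith [sq_nonneg (π - 1 / 2)])).trans_eq
        (Real.sqrt_sq (by norm_num : (0 : ℝ) ≤ 1 / 2))
    linarith
  set c := 2 * √(π * (1 - π)) with hcdef
  set K := ε + (1 - ε) * H with hK
  have hε0 := hε.1
  have hε1 : 0 ≤ 1 - ε := sub_nonneg.2 hε.2
  have hK0 : 0 < K := by
    rcases hε0.eq_or_lt with h0 | h0
    · rw [hK, ← h0]
      simpa using hH0
    · exact add_pos_of_pos_of_nonneg h0 (mul_nonneg hε1 hH0.le)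
  have hK1 : K ≤ 1 := by nlinarith
  have hL0 : 0 < c * K := mul_pos hc hK0
  have hL1 : c * K ≤ 1 := mul_le_one₀ hc1 hK0.le hK1
  -- After factoring out c, the goal Z - H ≤ ε(1 - H) is Z ≤ K. The exponents combine to
  -- (32/δ²)(2δ²) = 64; since cK ≤ 1, exponent 1 would already suffice, so the constant 32 leaves
  -- ample room.
  have hZ : (h T).affinity P U ≤ K := by
    calc (h T).affinity P U ≤ ((T : ℝ) + 1) ^ (-(2 * δ ^ 2)) := ha
      _ ≤ ((1 / (c * K)) ^ (32 / δ ^ 2)) ^ (-(2 * δ ^ 2)) := by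
          refine Real.rpow_le_rpow_of_nonpos (by positivity) (by linarith) ?_
          have := sq_nonneg δ
          linarith
      _ = (c * K) ^ (64 : ℝ) := by
          rw [← Real.rpow_mul (by positivity), one_div, Real.inv_rpow hL0.le,
            ← Real.rpow_neg hL0.le]
          congr 1
          field_simp
          norm_num
      _ ≤ (c * K) ^ (1 : ℝ) := Real.rpow_le_rpow_of_exponent_ge hL0 hL1 (by norm_num)
      _ = c * K := Real.rpow_one _
      _ ≤ K := mul_le_of_le_one_left hK0.le hc1
  have := mul_le_mul_of_nonneg_left hZ hc.le
  rw [hK] at this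
  linarith
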